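/- \textbf{Setting.} Let $\mathcal U$ (users), $\mathcal M$ (macro transmission points) and $\mathcal P$ (pico transmission points) be finite sets, and let $\mathcal P$ be the disjoint union of sets $\mathcal B_m$, $m\in\mathcal M$ (the picos assigned to macro $m$; $\mathcal B_m$ may be empty). For every user $u$ let peak rates $R_{u,s}>0$ ($s\in\mathcal M\sqcup\mathcal P$), a weight $w_u>0$ and rate limits $0\le R^{\min}_u\le R^{\max}_u\le\infty$ ($R^{\min}_u<\infty$) be given, such that $R_{u,m}/R_{u,b}\ne R_{u',m}/R_{u',b}$ for all $m\in\mathcal M$, $b\in\mathcal B_m$ and all users $u\neq u'$. Let $\Omega$ be the set of pairs $(u,b)\in\mathcal U\times\mathcal P$ with $R_{u,m}+R_{u,b}\ge R_u^{\min}$, where $m$ is the macro with $b\in\mathcal B_m$, and let $\Omega^{(m)}=\{(u,b)\in\Omega: b\in\mathcal B_m\}$. Let $\mathcal I$ be the family of all $G\subseteq\Omega$ in which every user occurs at most once. The weighted sum rate problem in the variables $z_{u,m},x_{u,b}\in\{0,1\}$ and $\theta_{u,m},\gamma_{u,b}\in[0,1]$ is to maximize $$\sum_{u}\sum_{m}\Big(w_uR_{u,m}\theta_{u,m}+\sum_{b\in\mathcal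 B_m}w_ux_{u,b}R_{u,b}\gamma_{u,b}\Big)$$ subject to $\sum_m z_{u,m}\le 1$ for all $u$, $\sum_{b\in\mathcal B_m}x_{u,b}=z_{u,m}$ for all $u,m$, $\sum_u\theta_{u,m}\le1$ for all $m$, $\sum_u\gamma_{u,b}\le 1$ for all $b$, and $$z_{u,m}R_u^{\min}\le R_{u,m}\theta_{u,m}+\sum_{b\in\mathcal B_m}x_{u,b}R_{u,b}\gamma_{u,b}\le z_{u,m}R_u^{\max}\quad\text{for all }u,m$$ (with $0\cdot\infty=0$). Let $\mathcal J$ be the family of all $G\in\mathcal I$ for which these constraints are feasible when $x$ is fixed to the indicator function of $G$. For $m\in\mathcal M$ and $A\subseteq\Omega^{(m)}$ in $\mathcal J$ let $f_m(A)$ be the optimal value of the linear program over allocation fractions $\theta_u,\gamma_{u,b}\in[0,1]$ $$\max\sum_{(u,b)\in A}w_u\big(R_{u,m}\theta_u+R_{u,b}\gamma_{u,b}\big)$$ subject to $\sum_{u:\,(u,b)\in A\text{ for some }b}\theta_u\le1$, $\sum_{u:\,(u,b)\in A}\gamma_{u,b}\le1$ for every pico $b$ that occurs in $A$, and $R_u^{\min}\le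 R_{u,m}\theta_u+R_{u,b}\gamma_{u,b}\le R_u^{\max}$ for all $(u,b)\in A$. Put $f^{\rm wsr}(G)=\sum_{m\in\mathcal M}f_m(G\cap\Omega^{(m)})$ for $G\in\mathcal J$. \textbf{Theorem.} (a) $\mathcal J$ contains $\emptyset$ and is downward closed. For every $G\in\mathcal J$ each of the linear programs defining $f_m(G\cap\Omega^{(m)})$ attains its maximum, and $f^{\rm wsr}(G)$ is the maximum of the weighted sum rate problem with $x$ fixed to the indicator function of $G$. (b) $f^{\rm wsr}$ is normalized, $f^{\rm wsr}(\emptyset)=0$, non-negative on $\mathcal J$, and submodular over $\mathcal J$: for all $A\subseteq B\in\mathcal J$ and $a\in\Omega\setminus B$ with $B\cup\{a\}\in\mathcal J$, $$f^{\rm wsr}(B\cup\{a\})-f^{\rm wsr}(B)\le f^{\rm wsr}(A\cup\{a\})-f^{\rm wsr}(A).$$ (c) $f^{\rm wsr}$ can be non-monotone: there is such a network for which there are $A\subseteq B$ in $\mathcal J$ with $f^{\rm wsr}(A)>f^{\rm wsr}(B)$, and also $A'\subseteq B'$ in $\mathcal J$ with $f^{\rm wsr}(A')<f^{\rm wsr}(B')$.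 -/

import Mathlib

namespace DualConn

/-- A dual-connectivity heterogeneous network with users `U`, macro TPs `M` and pico TPs `P`.
The set of all transmission points (TPs) is the disjoint union `M ⊕ P`, and every pico TP is
assigned to exactly one macro TP, so the set of picos assigned to `m` is `{b | macroOf b = m}`. -/
structure HetNet (U M P : Type*) where
  /-- the macro TP to which a pico TP is assigned -/
  macroOf : P → M
  /-- `R u s` is the peak rate of user `u` when it alone is served by TP `s` -/
  R : U → M ⊕ P → ℝ
  /-- the weight of a user -/
  w : U → ℝ
  /-- the minimum rate of a user -/
  Rmin : U → ℝ
  /-- the maximum rate of a user; the value `⊤` means that no maximum is imposed -/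
  Rmax : U → EReal
  R_pos : ∀ u s, 0 < R u s
  w_pos : ∀ u, 0 < w u
  Rmin_nonneg : ∀ u, 0 ≤ Rmin u
  Rmin_le_Rmax : ∀ u, (Rmin u : EReal) ≤ Rmax u
  ratio_ne : ∀ (b : P) (u u' : U), u ≠ u' →
    R u (Sum.inl (macroOf b)) / R u (Sum.inr b) ≠ R u' (Sum.inl (macroOf b)) / R u' (Sum.inr b)

namespace HetNet

variable {U M P : Type*} (N : HetNet U M P)

/-- The peak rate of user `u` from the macro TP `m`. -/
def RM (u : U) (m : M) : ℝ := N.R u (Sum.inl m)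

/-- The peak rate of user `u` from the pico TP `b`. -/
def RP (u : U) (b : P) : ℝ := N.R u (Sum.inr b)

/-! ### The joint weighted sum rate problem -/

/-- The picos assigned to the macro TP `m`. -/
def picos [Fintype P] [DecidableEq M] (m : M) : Finset P :=
  Finset.univ.filter (fun b => N.macroOf b = m)

/-- The total rate that user `u` gets from the macro TP `m` and its picos. -/
def rate [Fintype P] [DecidableEq M] (x : U → P → ℝ) (θ : U → M → ℝ) (γ : U → P → ℝ)
    (u : U) (m : M) : ℝ :=
  N.RM u m * θ u m + ∑ b ∈ N.picos m, x u b * N.RP u b * γ u b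

/-- The constraints of the joint weighted sum rate problem. The variables `z` and `x` are the
binary association variables, `θ` and `γ` are the allocation fractions. In `EReal` one has
`0 * ⊤ = 0`, so a user that is not associated with `m` gets rate zero from `m` and its picos. -/
structure WSRFeasible [Fintype U] [Fintype M] [Fintype P] [DecidableEq M]
    (z : U → M → ℝ) (x : U → P → ℝ) (θ : U → M → ℝ) (γ : U → P → ℝ) : Prop where
  z_mem : ∀ u m, z u m ∈ ({0, 1} : Set ℝ)
  x_mem : ∀ u b, x u b ∈ ({0, 1} : Set ℝ)
  θ_mem : ∀ u m, θ u m ∈ Set.Icc (0 : ℝ) 1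
  γ_mem : ∀ u b, γ u b ∈ Set.Icc (0 : ℝ) 1
  one_macro : ∀ u, ∑ m, z u m ≤ 1
  one_pico : ∀ u m, ∑ b ∈ N.picos m, x u b = z u m
  macro_budget : ∀ m, ∑ u, θ u m ≤ 1
  pico_budget : ∀ b, ∑ u, γ u b ≤ 1
  min_rate : ∀ u m, z u m * N.Rmin u ≤ N.rate x θ γ u m
  max_rate : ∀ u m, (N.rate x θ γ u m : EReal) ≤ (z u m : EReal) * N.Rmax u

/-- The weighted sum rate, the objective of the joint problem. -/
def wsr [Fintype U] [Fintype M] [Fintype P] [DecidableEq M]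
    (x : U → P → ℝ) (θ : U → M → ℝ) (γ : U → P → ℝ) : ℝ :=
  ∑ u, ∑ m, (N.w u * N.RM u m * θ u m +
    ∑ b ∈ N.picos m, N.w u * x u b * N.RP u b * γ u b)

/-! ### Associations -/

/-- The indicator variables `x` of a set of user–pico associations. -/
def assoc [DecidableEq U] [DecidableEq P] (G : Finset (U × P)) (u : U) (b : P) : ℝ :=
  if (u, b) ∈ G then 1 else 0

/-- The ground set of associations: the pairs `(u, b)` for which the minimum rate of `u` can be
met if `b` and its macro TP give all their resource to `u`. -/
def ground : Set (U × P) :=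
  {p | N.Rmin p.1 ≤ N.RM p.1 (N.macroOf p.2) + N.RP p.1 p.2}

/-- The sets of associations in which every user occurs at most once. -/
def indep [DecidableEq U] : Set (Finset (U × P)) :=
  {A | (A : Set (U × P)) ⊆ N.ground ∧ ∀ u, (A.filter (fun p => p.1 = u)).card ≤ 1}

/-- The feasible sets of associations: those for which the joint problem is feasible. -/
def feasible [Fintype U] [Fintype M] [Fintype P] [DecidableEq U] [DecidableEq M] [DecidableEq P] :
    Set (Finset (U × P)) :=
  {A | A ∈ N.indep ∧ ∃ z θ γ, N.WSRFeasible z (assoc A) θ γ}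

/-! ### The linear program of one macro TP, and the set function -/

/-- The constraints of the linear program over allocation fractions for the macro TP `m`, the
association `A` (to picos of `m`) and the budgets `Γ`, `Γb`. -/
structure LPFeasible [Fintype U] [DecidableEq U] [DecidableEq P]
    (m : M) (A : Finset (U × P)) (Γ : ℝ) (Γb : P → ℝ) (θ : U → ℝ) (γ : U → P → ℝ) : Prop where
  θ_mem : ∀ u, θ u ∈ Set.Icc (0 : ℝ) 1
  γ_mem : ∀ u b, γ u b ∈ Set.Icc (0 : ℝ) 1
  macro_budget : ∑ u ∈ A.image Prod.fst, θ u ≤ Γ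
  pico_budget : ∀ b ∈ A.image Prod.snd,
    ∑ u ∈ Finset.univ.filter (fun u => (u, b) ∈ A), γ u b ≤ Γb b
  min_rate : ∀ p ∈ A, N.Rmin p.1 ≤ N.RM p.1 m * θ p.1 + N.RP p.1 p.2 * γ p.1 p.2
  max_rate : ∀ p ∈ A,
    ((N.RM p.1 m * θ p.1 + N.RP p.1 p.2 * γ p.1 p.2 : ℝ) : EReal) ≤ N.Rmax p.1

/-- The objective of the linear program for the macro TP `m` and the association `A`. -/
def lpObj (m : M) (A : Finset (U × P)) (θ : U → ℝ) (γ : U → P → ℝ) : ℝ :=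
  ∑ p ∈ A, (N.w p.1 * N.RM p.1 m * θ p.1 + N.w p.1 * N.RP p.1 p.2 * γ p.1 p.2)

/-- The optimal value of the linear program (meaningful if the program is feasible). -/
noncomputable def lpOpt [Fintype U] [DecidableEq U] [DecidableEq P]
    (m : M) (A : Finset (U × P)) (Γ : ℝ) (Γb : P → ℝ) : ℝ :=
  sSup {v | ∃ θ γ, N.LPFeasible m A Γ Γb θ γ ∧ v = N.lpObj m A θ γ}

/-- The set function of the macro TP `m`: the optimal value under unit budgets. -/
noncomputable def fMacro [Fintype U] [DecidableEq U] [DecidableEq P]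
    (m : M) (A : Finset (U × P)) : ℝ :=
  N.lpOpt m A 1 (fun _ => 1)

/-- The weighted sum rate set function, the sum over all macro TPs `m` of the set function of `m`
at the associations to picos of `m`. -/
noncomputable def fwsr [Fintype U] [Fintype M] [DecidableEq U] [DecidableEq M] [DecidableEq P]
    (G : Finset (U × P)) : ℝ :=
  ∑ m, N.fMacro m (G.filter (fun p => N.macroOf p.2 = m))

end HetNet

/-- `h` is submodular over the family `J` of subsets of `Ω`. -/
def SubmodularOver {α : Type*} [DecidableEq α] (Ω : Set α) (J : Set (Finset α))
    (h : Finset α → ℝ) : Prop :=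
  ∀ A B : Finset α, A ⊆ B → B ∈ J → ∀ a ∈ Ω, a ∉ B → insert a B ∈ J →
    h (insert a B) - h B ≤ h (insert a A) - h A

end DualConn

/-! Fix a macro. Every association in its linear program is a demand that draws on two unit
resources, the macro and one pico. Under resource prices `p ≥ 0`, rate costs `min (p ρ / r) (p σ /
s)` per unit. Dualizing the budgets thus leaves a separable problem, with dual objective `∑ p k`
plus the best profit of each demand in `A`.

This unit price is monotone and turns `p ⊓ q` into a minimum, and the profit is antitone in it
because rates are nonnegative. Hence `profit (p ⊔ q) + profit (p ⊓ q) ≤ profit p + profit q`, and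
the dual objective is submodular jointly in demand set and prices: `A ∪ B` is priced by `p ⊔ q`, and
`A ∩ B` by `p ⊓ q` (`dualObj_union_add_inter_le`). Minimizing over prices keeps submodularity in the
set. Only weak duality and `ε`-optimal dual prices are used, so no Slater condition is needed.

The joint problem splits over macros: each pico has one macro, each user at most one association,
and `0 * ⊤ = 0` removes macro resource from unassociated users (`exists_wsrFeasible`,
`WSRFeasible.lpFeasible`). Monotonicity fails when a low-weight user with a large minimum rate takes
resource from a high-weight one. -/

namespace DualConn

/-! ### Approximate Lagrangian duality -/

/-- A form of Lagrangian duality without constraint qualification: over a compact convex set, the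
value of a linear maximization problem under linear budgets is approximated by nonnegative
prices. -/
theorem exists_prices_of_isCompact {E κ : Type*} [Fintype κ] [AddCommGroup E] [Module ℝ E]
    [TopologicalSpace E] {X : Set E} (hX : IsCompact X) (hconv : Convex ℝ X)
    (obj : E →L[ℝ] ℝ) (load : E →L[ℝ] (κ → ℝ)) (b : κ → ℝ) {f ε : ℝ} (hε : 0 < ε)
    (hex : ∃ x ∈ X, load x ≤ b ∧ obj x = f) (hle : ∀ x ∈ X, load x ≤ b → obj x ≤ f) :
    ∃ q : κ → ℝ, 0 ≤ q ∧ ∀ x ∈ X, obj x + ∑ k, q k * (b k - load x k) ≤ f + ε := by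
  classical
  -- The attainable pairs (value, load) are separated from the pairs of value at least `f + ε`
  -- within budget. The margin `ε` makes the two closed sets disjoint.
  have hD : IsCompact ((obj.prod load) '' X) := hX.image (obj.prod load).continuous
  have hDc : Convex ℝ ((obj.prod load) '' X) := hconv.linear_image (obj.prod load).toLinearMap
  have hQ : IsClosed (Set.Ici (f + ε) ×ˢ Set.Iic b) := isClosed_Ici.prod isClosed_Iic
  have hQc : Convex ℝ (Set.Ici (f + ε) ×ˢ Set.Iic b) := (convex_Ici _).prod (convex_Iic _)
  have hdisj : Disjoint ((obj.prod load) '' X) (Set.Ici (f + ε) ×ˢ Set.Iic b) := by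
    rw [Set.disjoint_left]
    rintro _ ⟨x, hx, rfl⟩ ⟨h1, h2⟩
    have h3 := hle x hx h2
    have h1' : f + ε ≤ obj x := h1
    linarith
  obtain ⟨ψ, u, v, h1, huv, h2⟩ := geometric_hahn_banach_compact_closed hDc hD hQc hQ hdisj
  set α : ℝ := ψ (1, 0) with hα
  set β : κ → ℝ := fun k => ψ (0, Pi.single k 1) with hβ
  have hψ : ∀ t c, ψ (t, c) = t * α + ∑ k, c k * β k := by
    intro t c
    have : ((t, c) : ℝ × (κ → ℝ)) = t • (1, 0) + ∑ k, c k • (0, Pi.single k 1) := by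
      ext j
      · simp [Prod.fst_sum]
      · simp [Prod.snd_sum, Finset.sum_apply, Pi.single_apply]
    rw [this, map_add, map_smul, map_sum, smul_eq_mul]
    congr 1
    exact Finset.sum_congr rfl fun k _ => by rw [map_smul, smul_eq_mul]
  -- The quadrant is unbounded downwards in each load coordinate; if `β k > 0`, moving by `T` in
  -- that direction would bring `ψ` down to `v` or below.
  have hβ0 : ∀ k, β k ≤ 0 := by
    intro k
    by_contra! hk
    set T : ℝ := max 0 ((ψ (f + ε, b) - v) / β k) with hT
    have h3 := h2 (f + ε, b - T • Pi.single k 1) ⟨le_refl (f + ε), by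
      intro j
      have : 0 ≤ T * (Pi.single k 1 : κ → ℝ) j :=
        mul_nonneg (le_max_left _ _) (by by_cases h : j = k <;> simp [h])
      simpa using this⟩
    have h4 : ψ (f + ε, b - T • Pi.single k 1) = ψ (f + ε, b) - T * β k := by
      rw [hψ, hψ]
      simp [sub_mul, Finset.sum_sub_distrib, Pi.single_apply]
      ring
    have h5 : (ψ (f + ε, b) - v) / β k * β k ≤ T * β k :=
      mul_le_mul_of_nonneg_right (le_max_right _ _) hk.le
    rw [div_mul_cancel₀ _ hk.ne'] at h5
    linarith
  obtain ⟨x₀, hx₀, hx₀b, hx₀f⟩ := hex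
  have hsum : ∀ x ∈ X, obj x * α + ∑ k, load x k * β k < (f + ε) * α + ∑ k, b k * β k := by
    intro x hx
    have h3 := h1 _ ⟨x, hx, rfl⟩
    have h4 := h2 (f + ε, b) ⟨le_refl (f + ε), le_refl b⟩
    rw [ContinuousLinearMap.prod_apply, hψ] at h3
    rw [hψ] at h4
    linarith
  -- The feasible point `x₀` rules out a vertical hyperplane: comparing it with the corner `(f + ε,
  -- b)` gives `0 < ε * α`.
  have hα0 : 0 < α := by
    have h3 := hsum x₀ hx₀
    have h4 : ∑ k, b k * β k ≤ ∑ k, load x₀ k * β k :=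
      Finset.sum_le_sum fun k _ => mul_le_mul_of_nonpos_right (hx₀b k) (hβ0 k)
    rw [hx₀f] at h3
    by_contra! h
    nlinarith
  refine ⟨fun k => -β k / α, fun k => div_nonneg (by simpa using hβ0 k) hα0.le, fun x hx => ?_⟩
  have h3 := hsum x hx
  have h4 : ∑ k, -β k / α * (b k - load x k) =
      (∑ k, load x k * β k - ∑ k, b k * β k) / α := by
    rw [← Finset.sum_sub_distrib, Finset.sum_div]
    exact Finset.sum_congr rfl fun k _ => by ring
  rw [h4]
  have h5 : (∑ k, load x k * β k - ∑ k, b k * β k) / α ≤ f + ε - obj x := by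
    rw [div_le_iff₀ hα0]
    linarith
  linarith

/-! ### Demands on two resources and their profit under prices -/

/-- A demand that can be served by two resources `ρ` and `σ`, at rates `r` and `s` per unit of the
resource; the total rate has weight `w` and must lie between `lo` and `hi`. -/
structure Demand (κ : Type*) where
  /-- the first resource -/
  ρ : κ
  /-- the second resource -/
  σ : κ
  /-- the rate per unit of the first resource -/
  r : ℝ
  /-- the rate per unit of the second resource -/
  s : ℝ
  /-- the weight -/
  w : ℝ
  /-- the minimum rate -/
  lo : ℝ
  /-- the maximum rate -/
  hi : ℝ

namespace Demand

variable {ι κ : Type*}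

/-- The rate obtained from the amounts `x` of the two resources. -/
def rate (d : Demand κ) (x : ℝ × ℝ) : ℝ := d.r * x.1 + d.s * x.2

/-- The admissible amounts of the two resources. -/
def admissible (d : Demand κ) : Set (ℝ × ℝ) :=
  {x | 0 ≤ x.1 ∧ 0 ≤ x.2 ∧ d.lo ≤ d.rate x ∧ d.rate x ≤ d.hi}

/-- The conditions on the data that are needed for a demand to make sense. -/
structure Valid (d : Demand κ) : Prop where
  r_pos : 0 < d.r
  s_pos : 0 < d.s
  lo_nonneg : 0 ≤ d.lo
  lo_le_hi : d.lo ≤ d.hi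

/-- The lowest price of a unit of rate under the prices `p` of the resources. -/
noncomputable def unitPrice (d : Demand κ) (p : κ → ℝ) : ℝ := min (p d.ρ / d.r) (p d.σ / d.s)

/-- The maximal profit that can be made from a demand under the prices `p`. -/
noncomputable def profit (d : Demand κ) (p : κ → ℝ) : ℝ :=
  max (d.lo * (d.w - d.unitPrice p)) (d.hi * (d.w - d.unitPrice p))

/-- A unit of rate costs at least `unitPrice` from either resource. What remains is linear in the
rate, hence largest at an endpoint of `[lo, hi]`. -/
theorem le_profit {d : Demand κ} (hd : d.Valid) (p : κ → ℝ) {x : ℝ × ℝ} (hx : x ∈ d.admissible) :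
    d.w * d.rate x - p d.ρ * x.1 - p d.σ * x.2 ≤ d.profit p := by
  obtain ⟨h1, h2, h3, h4⟩ := hx
  have ha : d.unitPrice p * d.r ≤ p d.ρ := by
    rw [← le_div_iff₀ hd.r_pos]; exact min_le_left _ _
  have hb : d.unitPrice p * d.s ≤ p d.σ := by
    rw [← le_div_iff₀ hd.s_pos]; exact min_le_right _ _
  have hc : d.w * d.rate x - p d.ρ * x.1 - p d.σ * x.2 ≤ d.rate x * (d.w - d.unitPrice p) := by
    have := mul_le_mul_of_nonneg_right ha h1
    have := mul_le_mul_of_nonneg_right hb h2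
    unfold rate
    linarith
  refine hc.trans ?_
  rcases le_total 0 (d.w - d.unitPrice p) with h | h
  · exact (mul_le_mul_of_nonneg_right h4 h).trans (le_max_right _ _)
  · exact (mul_le_mul_of_nonpos_right h3 h).trans (le_max_left _ _)

/-- Equality holds when the better endpoint rate is bought entirely from the cheaper resource. -/
theorem exists_eq_profit {d : Demand κ} (hd : d.Valid) (p : κ → ℝ) :
    ∃ x ∈ d.admissible, d.w * d.rate x - p d.ρ * x.1 - p d.σ * x.2 = d.profit p := by
  have key : ∀ y, d.lo ≤ y → y ≤ d.hi → ∃ x ∈ d.admissible,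
      d.w * d.rate x - p d.ρ * x.1 - p d.σ * x.2 = y * (d.w - d.unitPrice p) := by
    intro y h1 h2
    have hy : 0 ≤ y := hd.lo_nonneg.trans h1
    have hr := hd.r_pos
    have hs := hd.s_pos
    rcases min_choice (p d.ρ / d.r) (p d.σ / d.s) with h | h
    · have hrate : d.rate (y / d.r, 0) = y := by simp [rate]; field_simp
      refine ⟨(y / d.r, 0), ⟨div_nonneg hy hr.le, le_rfl, ?_, ?_⟩, ?_⟩
      · rwa [hrate]
      · rwa [hrate]
      · rw [hrate, unitPrice, h]; simp; field_simp
    · have hrate : d.rate (0, y / d.s) = y := by simp [rate]; field_simp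
      refine ⟨(0, y / d.s), ⟨le_rfl, div_nonneg hy hs.le, ?_, ?_⟩, ?_⟩
      · rwa [hrate]
      · rwa [hrate]
      · rw [hrate, unitPrice, h]; simp; field_simp
  rcases max_choice (d.lo * (d.w - d.unitPrice p)) (d.hi * (d.w - d.unitPrice p)) with h | h
  · rw [profit, h]; exact key _ le_rfl hd.lo_le_hi
  · rw [profit, h]; exact key _ hd.lo_le_hi le_rfl

theorem profit_le_of_unitPrice_le {d : Demand κ} (hd : d.Valid) {p q : κ → ℝ}
    (h : d.unitPrice p ≤ d.unitPrice q) : d.profit q ≤ d.profit p := by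
  have hhi := hd.lo_nonneg.trans hd.lo_le_hi
  exact max_le_max (mul_le_mul_of_nonneg_left (by linarith) hd.lo_nonneg)
    (mul_le_mul_of_nonneg_left (by linarith) hhi)

theorem unitPrice_mono {d : Demand κ} (hd : d.Valid) {p q : κ → ℝ} (h : p ≤ q) :
    d.unitPrice p ≤ d.unitPrice q :=
  min_le_min (div_le_div_of_nonneg_right (h _) hd.r_pos.le)
    (div_le_div_of_nonneg_right (h _) hd.s_pos.le)

/-- Minima commute with each other and with division by positive rates. This exact identity for
meets is the source of submodularity; for joins monotonicity suffices. -/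
theorem unitPrice_inf {d : Demand κ} (hd : d.Valid) (p q : κ → ℝ) :
    d.unitPrice (p ⊓ q) = min (d.unitPrice p) (d.unitPrice q) := by
  simp only [unitPrice, Pi.inf_apply]
  rw [← min_div_div_right hd.r_pos.le, ← min_div_div_right hd.s_pos.le, min_min_min_comm]

theorem profit_anti {d : Demand κ} (hd : d.Valid) {p q : κ → ℝ} (h : p ≤ q) :
    d.profit q ≤ d.profit p :=
  profit_le_of_unitPrice_le hd (unitPrice_mono hd h)

/-- The profit is submodular in the prices. -/
theorem profit_sup_add_profit_inf_le {d : Demand κ} (hd : d.Valid) (p q : κ → ℝ) :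
    d.profit (p ⊔ q) + d.profit (p ⊓ q) ≤ d.profit p + d.profit q := by
  have h := unitPrice_inf hd p q
  -- The meet has the smaller of the two unit prices, and the join at least the larger one.
  rcases le_total (d.unitPrice p) (d.unitPrice q) with h' | h'
  · rw [min_eq_left h'] at h
    have h1 := profit_le_of_unitPrice_le hd h.ge
    have h2 := profit_anti hd (le_sup_right : q ≤ p ⊔ q)
    linarith
  · rw [min_eq_right h'] at h
    have h1 := profit_le_of_unitPrice_le hd h.ge
    have h2 := profit_anti hd (le_sup_left : p ≤ p ⊔ q)
    linarith

theorem convex_admissible (d : Demand κ) : Convex ℝ d.admissible := by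
  rintro x ⟨h1, h2, h3, h4⟩ y ⟨k1, k2, k3, k4⟩ a b ha hb hab
  have hr : d.rate (a • x + b • y) = a * d.rate x + b * d.rate y := by
    simp [rate]; ring
  refine ⟨?_, ?_, ?_, ?_⟩
  · simp only [Prod.fst_add, Prod.smul_fst, smul_eq_mul]; positivity
  · simp only [Prod.snd_add, Prod.smul_snd, smul_eq_mul]; positivity
  · rw [hr]; exact convex_Ici _ (Set.mem_Ici.2 h3) (Set.mem_Ici.2 k3) ha hb hab
  · rw [hr]; exact convex_Iic _ (Set.mem_Iic.2 h4) (Set.mem_Iic.2 k4) ha hb hab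

theorem isCompact_admissible {d : Demand κ} (hd : d.Valid) : IsCompact d.admissible := by
  have hr := hd.r_pos
  have hs := hd.s_pos
  refine (isCompact_Icc (a := ((0, 0) : ℝ × ℝ))
    (b := (d.hi / d.r, d.hi / d.s))).of_isClosed_subset ?_ ?_
  · have hc : Continuous d.rate := by unfold rate; fun_prop
    exact (isClosed_le continuous_const continuous_fst).inter
      ((isClosed_le continuous_const continuous_snd).inter
        ((isClosed_le continuous_const hc).inter (isClosed_le hc continuous_const)))
  · rintro x ⟨h1, h2, h3, h4⟩
    unfold rate at h4
    refine ⟨⟨h1, h2⟩, ⟨?_, ?_⟩⟩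
    · simp only [le_div_iff₀ hr]; nlinarith [mul_nonneg hs.le h2]
    · simp only [le_div_iff₀ hs]; nlinarith [mul_nonneg hr.le h1]

/-! ### Primal and dual programs for a set of demands -/

section Programs

variable (d : ι → Demand κ)

/-- The amount of the resource `k` that the demands in `A` use. -/
def load [DecidableEq κ] (A : Finset ι) (x : ι → ℝ × ℝ) (k : κ) : ℝ :=
  ∑ i ∈ A, ((if (d i).ρ = k then (x i).1 else 0) + (if (d i).σ = k then (x i).2 else 0))

/-- The weighted sum of the rates of the demands in `A`. -/
def total (A : Finset ι) (x : ι → ℝ × ℝ) : ℝ := ∑ i ∈ A, (d i).w * (d i).rate (x i)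

/-- The values that the weighted sum rate of the demands in `A` can take when one unit of each
resource is available. -/
def values [DecidableEq κ] (A : Finset ι) : Set ℝ :=
  {v | ∃ x : ι → ℝ × ℝ, (∀ i ∈ A, x i ∈ (d i).admissible) ∧ (∀ k, load d A x k ≤ 1) ∧
    v = total d A x}

/-- The dual objective. -/
noncomputable def dualObj [Fintype κ] (A : Finset ι) (p : κ → ℝ) : ℝ :=
  ∑ k, p k + ∑ i ∈ A, (d i).profit p

theorem sum_mul_load [Fintype κ] [DecidableEq κ] (A : Finset ι) (p : κ → ℝ) (x : ι → ℝ × ℝ) :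
    ∑ k, p k * load d A x k = ∑ i ∈ A, (p (d i).ρ * (x i).1 + p (d i).σ * (x i).2) := by
  simp only [load, Finset.mul_sum]
  rw [Finset.sum_comm]
  refine Finset.sum_congr rfl fun i _ => ?_
  simp [mul_add, Finset.sum_add_distrib]

theorem le_dualObj [Fintype κ] [DecidableEq κ] {A : Finset ι} (hd : ∀ i ∈ A, (d i).Valid) {p : κ → ℝ} (hp : 0 ≤ p) {v : ℝ}
    (hv : v ∈ values d A) : v ≤ dualObj d A p := by
  obtain ⟨x, hx, hl, rfl⟩ := hv
  have h1 : ∑ k, p k * load d A x k ≤ ∑ k, p k :=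
    Finset.sum_le_sum fun k _ => mul_le_of_le_one_right (hp k) (hl k)
  have h2 := Finset.sum_le_sum fun i hi => le_profit (hd i hi) p (hx i hi)
  rw [sum_mul_load] at h1
  simp only [Finset.sum_sub_distrib, Finset.sum_add_distrib] at h1 h2
  unfold total dualObj
  linarith

/-- The Lagrangian is separable over demands, so letting each demand maximize its own profit turns
the price bound into a bound on the dual objective. -/
theorem exists_dualObj_le [Finite ι] [Fintype κ] [DecidableEq ι] [DecidableEq κ]
    {A : Finset ι} (hd : ∀ i ∈ A, (d i).Valid) {f ε : ℝ}
    (hf : IsGreatest (values d A) f) (hε : 0 < ε) :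
    ∃ p : κ → ℝ, 0 ≤ p ∧ dualObj d A p ≤ f + ε := by
  -- Coordinates outside `A` affect neither load nor value; pinning them to `0` makes the product
  -- compact.
  set X : Set (ι → ℝ × ℝ) :=
    Set.pi Set.univ fun i => if i ∈ A then (d i).admissible else {0} with hXdef
  have hX : IsCompact X := by
    refine isCompact_univ_pi fun i => ?_
    split_ifs with h
    · exact isCompact_admissible (hd i h)
    · exact isCompact_singleton
  have hXc : Convex ℝ X := by
    refine convex_pi fun i _ => ?_
    split_ifs
    · exact convex_admissible _
    · exact convex_singleton _
  have hmem : ∀ x : ι → ℝ × ℝ, (∀ i ∈ A, x i ∈ (d i).admissible) →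
      (fun i => if i ∈ A then x i else 0) ∈ X := by
    intro x hx i _
    by_cases h : i ∈ A
    · simpa [h] using hx i h
    · simp [h]
  have hadm : ∀ x ∈ X, ∀ i ∈ A, x i ∈ (d i).admissible := by
    intro x hx i hi
    simpa [hi] using hx i (Set.mem_univ i)
  let obj : (ι → ℝ × ℝ) →ₗ[ℝ] ℝ :=
    { toFun := total d A
      map_add' := fun x y => by
        simp only [total, rate, ← Finset.sum_add_distrib, Pi.add_apply, Prod.fst_add, Prod.snd_add]
        exact Finset.sum_congr rfl fun i _ => by ring
      map_smul' := fun c x => by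
        simp only [total, rate, smul_eq_mul, Finset.mul_sum, Pi.smul_apply, Prod.smul_fst,
          Prod.smul_snd, RingHom.id_apply]
        exact Finset.sum_congr rfl fun i _ => by ring }
  let ld : (ι → ℝ × ℝ) →ₗ[ℝ] (κ → ℝ) :=
    { toFun := load d A
      map_add' := fun x y => by
        ext k
        simp only [load, ← Finset.sum_add_distrib, Pi.add_apply, Prod.fst_add, Prod.snd_add]
        exact Finset.sum_congr rfl fun i _ => by split_ifs <;> ring
      map_smul' := fun c x => by
        ext k
        simp only [load, smul_eq_mul, Finset.mul_sum, Pi.smul_apply, Prod.smul_fst,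
          Prod.smul_snd, RingHom.id_apply]
        exact Finset.sum_congr rfl fun i _ => by split_ifs <;> ring }
  have hfeas : ∃ x ∈ X, LinearMap.toContinuousLinearMap ld x ≤ (fun _ => 1) ∧
      LinearMap.toContinuousLinearMap obj x = f := by
    obtain ⟨x, hx, hl, rfl⟩ := hf.1
    have e1 : load d A (fun i => if i ∈ A then x i else 0) = load d A x := by
      ext k
      exact Finset.sum_congr rfl fun i hi => by simp [hi]
    have e2 : total d A (fun i => if i ∈ A then x i else 0) = total d A x :=
      Finset.sum_congr rfl fun i hi => by simp [hi]
    refine ⟨_, hmem x hx, ?_, e2⟩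
    change load d A _ ≤ _
    rw [e1]
    exact hl
  obtain ⟨p, hp, h⟩ := exists_prices_of_isCompact hX hXc (LinearMap.toContinuousLinearMap obj)
    (LinearMap.toContinuousLinearMap ld) (fun _ => 1) hε hfeas
    (fun x hx hl => hf.2 ⟨x, hadm x hx, hl, rfl⟩)
  refine ⟨p, hp, ?_⟩
  have hch : ∀ i, ∃ x : ℝ × ℝ, i ∈ A → x ∈ (d i).admissible ∧
      (d i).w * (d i).rate x - p (d i).ρ * x.1 - p (d i).σ * x.2 = (d i).profit p := by
    intro i
    by_cases hi : i ∈ A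
    · obtain ⟨x, hx, e⟩ := exists_eq_profit (hd i hi) p
      exact ⟨x, fun _ => ⟨hx, e⟩⟩
    · exact ⟨0, fun h => absurd h hi⟩
  choose x hx using hch
  have h3 := h _ (hmem x fun i hi => (hx i hi).1)
  change total d A _ + ∑ k, p k * (1 - load d A _ k) ≤ _ at h3
  have h4 : ∀ y : ι → ℝ × ℝ, total d A y + ∑ k, p k * (1 - load d A y k) =
      ∑ k, p k + ∑ i ∈ A, ((d i).w * (d i).rate (y i) - p (d i).ρ * (y i).1
        - p (d i).σ * (y i).2) := by
    intro y
    simp only [mul_sub, mul_one, Finset.sum_sub_distrib, sum_mul_load, Finset.sum_add_distrib,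
      total]
    ring
  rw [h4] at h3
  refine le_trans (le_of_eq ?_) h3
  unfold dualObj
  congr 1
  exact Finset.sum_congr rfl fun i hi => by simp [hi, ← (hx i hi).2]

/-- The price sums balance since `max + min` is the sum. A demand in both sets contributes by
submodularity of its profit; a demand in only one set sees its prices rise to `p ⊔ q`, which cannot
increase its profit. -/
theorem dualObj_union_add_inter_le [Fintype κ] [DecidableEq ι] {A B : Finset ι} (hA : ∀ i ∈ A, (d i).Valid)
    (hB : ∀ i ∈ B, (d i).Valid) (p q : κ → ℝ) :
    dualObj d (A ∪ B) (p ⊔ q) + dualObj d (A ∩ B) (p ⊓ q) ≤ dualObj d A p + dualObj d B q := by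
  have h1 : ∑ k, (p ⊔ q) k + ∑ k, (p ⊓ q) k = ∑ k, p k + ∑ k, q k := by
    simp only [← Finset.sum_add_distrib, Pi.sup_apply, Pi.inf_apply, max_add_min]
  have h2 : ∑ i ∈ A ∪ B, (d i).profit (p ⊔ q) + ∑ i ∈ A ∩ B, (d i).profit (p ⊓ q) ≤
      ∑ i ∈ A, (d i).profit p + ∑ i ∈ B, (d i).profit q := by
    have e1 : ∀ F : ι → ℝ, ∑ i ∈ A, F i = ∑ i ∈ A ∪ B, if i ∈ A then F i else 0 := fun F => by
      rw [Finset.sum_ite_mem, Finset.union_inter_cancel_left]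
    have e2 : ∀ F : ι → ℝ, ∑ i ∈ B, F i = ∑ i ∈ A ∪ B, if i ∈ B then F i else 0 := fun F => by
      rw [Finset.sum_ite_mem, Finset.union_inter_cancel_right]
    have e3 : ∀ F : ι → ℝ, ∑ i ∈ A ∩ B, F i = ∑ i ∈ A ∪ B, if i ∈ A ∩ B then F i else 0 :=
      fun F => by
        rw [Finset.sum_ite_mem]
        congr 1
        ext i
        simp only [Finset.mem_inter, Finset.mem_union]
        tauto
    rw [e1, e2, e3, ← Finset.sum_add_distrib, ← Finset.sum_add_distrib]
    refine Finset.sum_le_sum fun i hi => ?_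
    by_cases ha : i ∈ A <;> by_cases hb : i ∈ B
    · simpa [ha, hb] using profit_sup_add_profit_inf_le (hA i ha) p q
    · simpa [ha, hb] using profit_anti (hA i ha) (le_sup_left : p ≤ p ⊔ q)
    · simpa [ha, hb] using profit_anti (hB i hb) (le_sup_right : q ≤ p ⊔ q)
    · simp_all
  unfold dualObj
  linarith

/-- The optimal value is submodular in the set of demands. -/
theorem isGreatest_union_add_inter_le [Finite ι] [Fintype κ] [DecidableEq ι] [DecidableEq κ]
    {A B : Finset ι} (hA : ∀ i ∈ A, (d i).Valid)
    (hB : ∀ i ∈ B, (d i).Valid) {vA vB vU vI : ℝ} (hvA : IsGreatest (values d A) vA)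
    (hvB : IsGreatest (values d B) vB) (hvU : IsGreatest (values d (A ∪ B)) vU)
    (hvI : IsGreatest (values d (A ∩ B)) vI) : vU + vI ≤ vA + vB := by
  refine le_of_forall_pos_le_add fun ε hε => ?_
  obtain ⟨p, hp, h1⟩ := exists_dualObj_le d hA hvA (half_pos hε)
  obtain ⟨q, hq, h2⟩ := exists_dualObj_le d hB hvB (half_pos hε)
  have h3 := le_dualObj d (p := p ⊔ q)
    (fun i hi => (Finset.mem_union.1 hi).elim (hA i) (hB i)) (hp.trans le_sup_left) hvU.1
  have h4 := le_dualObj d (p := p ⊓ q)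
    (fun i hi => hA i (Finset.mem_inter.1 hi).1) (le_inf hp hq) hvI.1
  have h5 := dualObj_union_add_inter_le d hA hB p q
  linarith

end Programs

end Demand

end DualConn
namespace DualConn

namespace HetNet

variable {U M P : Type*} (N : HetNet U M P)

/-! ### The program of one macro TP -/

theorem RM_pos (u : U) (m : M) : 0 < N.RM u m := N.R_pos u _

theorem RP_pos (u : U) (b : P) : 0 < N.RP u b := N.R_pos u _

theorem injOn_fst_of_mem_indep [DecidableEq U] {A : Finset (U × P)} (hA : A ∈ N.indep) :
    Set.InjOn Prod.fst (A : Set (U × P)) := by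
  intro p hp q hq h
  exact Finset.card_le_one.1 (hA.2 q.1) p (Finset.mem_filter.2 ⟨hp, h⟩) q
    (Finset.mem_filter.2 ⟨hq, rfl⟩)

theorem mem_indep_of_subset [DecidableEq U] {A B : Finset (U × P)} (h : A ⊆ B)
    (hB : B ∈ N.indep) : A ∈ N.indep :=
  ⟨(Finset.coe_subset.2 h).trans hB.1,
    fun u => (Finset.card_le_card (Finset.filter_subset_filter _ h)).trans (hB.2 u)⟩

theorem sum_ite_snd_eq [Fintype U] [DecidableEq U] [DecidableEq P] (A : Finset (U × P)) (b : P)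
    (g : U × P → ℝ) :
    ∑ p ∈ A, (if p.2 = b then g p else 0) =
      ∑ u ∈ Finset.univ.filter (fun u => (u, b) ∈ A), g (u, b) := by
  rw [← Finset.sum_filter]
  refine Finset.sum_nbij' Prod.fst (fun u => (u, b)) ?_ ?_ ?_ ?_ ?_
  · rintro ⟨u, c⟩ h
    obtain ⟨h1, h2⟩ := Finset.mem_filter.1 h
    obtain rfl : c = b := h2
    simpa using h1
  · intro u h
    simpa using h
  · rintro ⟨u, c⟩ h
    obtain ⟨h1, h2⟩ := Finset.mem_filter.1 h
    obtain rfl : c = b := h2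
    rfl
  · intro u _
    rfl
  · rintro ⟨u, c⟩ h
    obtain ⟨h1, h2⟩ := Finset.mem_filter.1 h
    obtain rfl : c = b := h2
    rfl

/-- The demand of a user–pico association towards the macro TP `m` and the pico. Since only one unit
of each resource is available, the rate can be capped. -/
noncomputable def demand (m : M) (p : U × P) : Demand (Option P) where
  ρ := none
  σ := some p.2
  r := N.RM p.1 m
  s := N.RP p.1 p.2
  w := N.w p.1
  lo := N.Rmin p.1
  hi := (min (N.Rmax p.1) ((N.RM p.1 m + N.RP p.1 p.2 : ℝ) : EReal)).toReal

theorem le_demand_hi_iff (m : M) (p : U × P) (y : ℝ) :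
    y ≤ (N.demand m p).hi ↔ (y : EReal) ≤ N.Rmax p.1 ∧ y ≤ N.RM p.1 m + N.RP p.1 p.2 := by
  -- `toReal` is faithful only away from `⊤` and `⊥`; the cap excludes the first, nonnegativity the
  -- second.
  have h1 : min (N.Rmax p.1) ((N.RM p.1 m + N.RP p.1 p.2 : ℝ) : EReal) ≠ ⊤ :=
    ne_top_of_le_ne_top (EReal.coe_ne_top _) (min_le_right _ _)
  have h2 : min (N.Rmax p.1) ((N.RM p.1 m + N.RP p.1 p.2 : ℝ) : EReal) ≠ ⊥ := by
    refine ne_bot_of_le_ne_bot (EReal.coe_ne_bot 0) (le_min ?_ ?_)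
    · exact (EReal.coe_le_coe_iff.2 (N.Rmin_nonneg p.1)).trans (N.Rmin_le_Rmax p.1)
    · exact EReal.coe_le_coe_iff.2 (add_pos (N.RM_pos _ _) (N.RP_pos _ _)).le
  rw [← EReal.coe_le_coe_iff, demand, EReal.coe_toReal h1 h2, le_min_iff, EReal.coe_le_coe_iff]

/-- Membership in the ground set is what keeps the minimum rate below the cap `RM + RP`. -/
theorem valid_demand {m : M} {p : U × P} (hp : p ∈ N.ground) (hm : N.macroOf p.2 = m) :
    (N.demand m p).Valid where
  r_pos := N.RM_pos _ _
  s_pos := N.RP_pos _ _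
  lo_nonneg := N.Rmin_nonneg _
  lo_le_hi := (N.le_demand_hi_iff m p _).2 ⟨N.Rmin_le_Rmax _, hm ▸ hp⟩

theorem load_none [DecidableEq P] (m : M) (A : Finset (U × P)) (x : U × P → ℝ × ℝ) :
    Demand.load (N.demand m) A x none = ∑ p ∈ A, (x p).1 := by
  simp [Demand.load, demand]

theorem load_some [Fintype U] [DecidableEq U] [DecidableEq P] (m : M) (A : Finset (U × P))
    (x : U × P → ℝ × ℝ) (b : P) :
    Demand.load (N.demand m) A x (some b) =
      ∑ u ∈ Finset.univ.filter (fun u => (u, b) ∈ A), (x (u, b)).2 := by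
  rw [← sum_ite_snd_eq A b fun p => (x p).2]
  simp [Demand.load, demand]

section LP

variable [Fintype U] [DecidableEq U] [DecidableEq P]

/-- The cap on the rate follows from fractions at most `1`; conversely that bound on fractions
follows from the unit budgets and nonnegativity. -/
theorem setOf_lpObj_eq_values (m : M) {A : Finset (U × P)}
    (hA : Set.InjOn Prod.fst (A : Set (U × P))) :
    {v | ∃ θ γ, N.LPFeasible m A 1 (fun _ => 1) θ γ ∧ v = N.lpObj m A θ γ} =
      Demand.values (N.demand m) A := by
  have hsum : ∀ θ : U → ℝ, ∑ u ∈ A.image Prod.fst, θ u = ∑ p ∈ A, θ p.1 := fun θ =>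
    Finset.sum_image hA
  ext v
  constructor
  · rintro ⟨θ, γ, h, rfl⟩
    refine ⟨fun p => (θ p.1, γ p.1 p.2), fun p hp => ⟨(h.θ_mem _).1, (h.γ_mem _ _).1,
      h.min_rate p hp, (N.le_demand_hi_iff m p _).2 ⟨h.max_rate p hp, ?_⟩⟩, ?_, ?_⟩
    · exact add_le_add (mul_le_of_le_one_right (N.RM_pos _ _).le (h.θ_mem _).2)
        (mul_le_of_le_one_right (N.RP_pos _ _).le (h.γ_mem _ _).2)
    · rintro (_ | b)
      · rw [load_none, ← hsum]
        exact h.macro_budget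
      · rw [load_some]
        by_cases hb : b ∈ A.image Prod.snd
        · exact h.pico_budget b hb
        · rw [Finset.sum_eq_zero]
          · exact zero_le_one
          · intro u hu
            exact absurd (Finset.mem_image.2 ⟨_, (Finset.mem_filter.1 hu).2, rfl⟩) hb
    · refine Finset.sum_congr rfl fun p _ => ?_
      simp only [Demand.rate, demand]
      ring
  · rintro ⟨x, hx, hl, rfl⟩
    have hl1 := hl none
    rw [load_none] at hl1
    have hl2 : ∀ b, ∑ u ∈ Finset.univ.filter (fun u => (u, b) ∈ A), (x (u, b)).2 ≤ 1 := fun b => by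
      rw [← load_some N m]
      exact hl (some b)
    -- By injectivity on users at most one summand is nonzero; users outside `A` receive `0`.
    set θ : U → ℝ := fun u => ∑ p ∈ A, if p.1 = u then (x p).1 else 0 with hθ
    have hθ1 : ∀ p ∈ A, θ p.1 = (x p).1 := by
      intro p hp
      rw [hθ]
      refine (Finset.sum_eq_single_of_mem p hp fun q hq hqp => if_neg fun e => hqp ?_).trans
        (if_pos rfl)
      exact hA hq hp e
    refine ⟨θ, fun u b => if (u, b) ∈ A then (x (u, b)).2 else 0, ⟨?_, ?_, ?_, ?_, ?_, ?_⟩, ?_⟩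
    · intro u
      refine ⟨Finset.sum_nonneg fun p hp => ?_, (Finset.sum_le_sum fun p hp => ?_).trans hl1⟩
      · split_ifs
        exacts [(hx p hp).1, le_rfl]
      · split_ifs
        exacts [le_rfl, (hx p hp).1]
    · intro u b
      split_ifs with h
      · refine ⟨(hx _ h).2.1, le_trans ?_ (hl2 b)⟩
        exact Finset.single_le_sum (f := fun u => (x (u, b)).2)
          (fun v hv => (hx _ (Finset.mem_filter.1 hv).2).2.1) (Finset.mem_filter.2
            ⟨Finset.mem_univ u, h⟩)
      · exact ⟨le_rfl, zero_le_one⟩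
    · rw [hsum, Finset.sum_congr rfl hθ1]
      exact hl1
    · intro b _
      refine le_trans (le_of_eq (Finset.sum_congr rfl fun u hu => ?_)) (hl2 b)
      exact if_pos (Finset.mem_filter.1 hu).2
    · intro p hp
      rw [hθ1 p hp, if_pos hp]
      exact (hx p hp).2.2.1
    · intro p hp
      rw [hθ1 p hp, if_pos hp]
      exact ((N.le_demand_hi_iff m p _).1 (hx p hp).2.2.2).1
    · refine Finset.sum_congr rfl fun p hp => ?_
      simp only [Demand.rate, demand]
      rw [hθ1 p hp, if_pos hp]
      ring

theorem isCompact_setOf_LPFeasible (m : M) (A : Finset (U × P)) (Γ : ℝ) (Γb : P → ℝ) :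
    IsCompact {x : (U → ℝ) × (U → P → ℝ) | N.LPFeasible m A Γ Γb x.1 x.2} := by
  refine (isCompact_Icc (a := (0 : (U → ℝ) × (U → P → ℝ))) (b := 1)).of_isClosed_subset ?_ ?_
  · have : {x : (U → ℝ) × (U → P → ℝ) | N.LPFeasible m A Γ Γb x.1 x.2} =
        {x | (∀ u, x.1 u ∈ Set.Icc (0 : ℝ) 1) ∧ (∀ u b, x.2 u b ∈ Set.Icc (0 : ℝ) 1) ∧
          (∑ u ∈ A.image Prod.fst, x.1 u ≤ Γ) ∧
          (∀ b ∈ A.image Prod.snd,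
            ∑ u ∈ Finset.univ.filter (fun u => (u, b) ∈ A), x.2 u b ≤ Γb b) ∧
          (∀ p ∈ A, N.Rmin p.1 ≤ N.RM p.1 m * x.1 p.1 + N.RP p.1 p.2 * x.2 p.1 p.2) ∧
          ∀ p ∈ A, ((N.RM p.1 m * x.1 p.1 + N.RP p.1 p.2 * x.2 p.1 p.2 : ℝ) : EReal) ≤
            N.Rmax p.1} := by
      ext x
      exact ⟨fun ⟨a, b, c, d, e, f⟩ => ⟨a, b, c, d, e, f⟩,
        fun ⟨a, b, c, d, e, f⟩ => ⟨a, b, c, d, e, f⟩⟩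
    rw [this]
    simp only [Set.ofPred_and, Set.ofPred_forall]
    refine IsClosed.inter ?_ <| IsClosed.inter ?_ <| IsClosed.inter ?_ <| IsClosed.inter ?_ <|
      IsClosed.inter ?_ ?_
    · exact isClosed_iInter fun u => isClosed_Icc.preimage (by fun_prop)
    · exact isClosed_iInter fun u => isClosed_iInter fun b => isClosed_Icc.preimage (by fun_prop)
    · exact isClosed_le (by fun_prop) continuous_const
    · exact isClosed_iInter fun b => isClosed_iInter fun _ =>
        isClosed_le (by fun_prop) continuous_const
    · exact isClosed_iInter fun b => isClosed_iInter fun _ =>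
        isClosed_le continuous_const (by fun_prop)
    · exact isClosed_iInter fun b => isClosed_iInter fun _ =>
        isClosed_le (continuous_coe_real_ereal.comp (by fun_prop)) continuous_const
  · intro x hx
    exact ⟨⟨fun u => (hx.θ_mem u).1, fun u b => (hx.γ_mem u b).1⟩,
      ⟨fun u => (hx.θ_mem u).2, fun u b => (hx.γ_mem u b).2⟩⟩

/-- A feasible linear program attains its maximum. -/
theorem isGreatest_lpOpt {m : M} {A : Finset (U × P)} {Γ : ℝ} {Γb : P → ℝ}
    (h : ∃ θ γ, N.LPFeasible m A Γ Γb θ γ) :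
    IsGreatest {v | ∃ θ γ, N.LPFeasible m A Γ Γb θ γ ∧ v = N.lpObj m A θ γ}
      (N.lpOpt m A Γ Γb) := by
  have hc : Continuous fun x : (U → ℝ) × (U → P → ℝ) => N.lpObj m A x.1 x.2 := by
    unfold lpObj
    fun_prop
  have himage : {v | ∃ θ γ, N.LPFeasible m A Γ Γb θ γ ∧ v = N.lpObj m A θ γ} =
      (fun x : (U → ℝ) × (U → P → ℝ) => N.lpObj m A x.1 x.2) ''
        {x | N.LPFeasible m A Γ Γb x.1 x.2} := by
    ext v
    constructor
    · rintro ⟨θ, γ, h, rfl⟩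
      exact ⟨(θ, γ), h, rfl⟩
    · rintro ⟨⟨θ, γ⟩, h, rfl⟩
      exact ⟨θ, γ, h, rfl⟩
  obtain ⟨θ, γ, hθγ⟩ := h
  unfold lpOpt
  rw [himage]
  exact ((N.isCompact_setOf_LPFeasible m A Γ Γb).image hc).isGreatest_sSup
    ⟨_, Set.mem_image_of_mem _ (show (θ, γ) ∈ _ from hθγ)⟩

variable {N} in
theorem LPFeasible.anti {m : M} {A B : Finset (U × P)} {Γ : ℝ} {Γb : P → ℝ} {θ : U → ℝ}
    {γ : U → P → ℝ} (h : N.LPFeasible m B Γ Γb θ γ) (hAB : A ⊆ B) :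
    N.LPFeasible m A Γ Γb θ γ where
  θ_mem := h.θ_mem
  γ_mem := h.γ_mem
  macro_budget := (Finset.sum_le_sum_of_subset_of_nonneg (Finset.image_subset_image hAB)
    fun u _ _ => (h.θ_mem u).1).trans h.macro_budget
  pico_budget b hb := (Finset.sum_le_sum_of_subset_of_nonneg
    (Finset.monotone_filter_right _ fun _ _ hu => hAB hu)
    fun u _ _ => (h.γ_mem u b).1).trans (h.pico_budget b (Finset.image_subset_image hAB hb))
  min_rate p hp := h.min_rate p (hAB hp)
  max_rate p hp := h.max_rate p (hAB hp)

theorem lpObj_nonneg {m : M} {A : Finset (U × P)} {Γ : ℝ} {Γb : P → ℝ} {θ : U → ℝ}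
    {γ : U → P → ℝ} (h : N.LPFeasible m A Γ Γb θ γ) : 0 ≤ N.lpObj m A θ γ :=
  Finset.sum_nonneg fun _ _ => add_nonneg
    (mul_nonneg (mul_pos (N.w_pos _) (N.RM_pos _ _)).le (h.θ_mem _).1)
    (mul_nonneg (mul_pos (N.w_pos _) (N.RP_pos _ _)).le (h.γ_mem _ _).1)

theorem LPFeasible_empty (m : M) :
    N.LPFeasible m ∅ 1 (fun _ => 1) (fun _ => 0) (fun _ _ => 0) where
  θ_mem _ := ⟨le_rfl, zero_le_one⟩
  γ_mem _ _ := ⟨le_rfl, zero_le_one⟩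
  macro_budget := by simp
  pico_budget := by simp
  min_rate := by simp
  max_rate := by simp

theorem fMacro_empty (m : M) : N.fMacro m ∅ = 0 := by
  obtain ⟨θ, γ, -, h⟩ := (N.isGreatest_lpOpt ⟨_, _, N.LPFeasible_empty m⟩).1
  exact h

/-- The set function of a macro TP is submodular. -/
theorem fMacro_insert_sub_le [Fintype P] {m : M} {A B : Finset (U × P)} {a : U × P} (hAB : A ⊆ B)
    (ha : a ∉ B) (hB : insert a B ∈ N.indep) (hm : ∀ p ∈ insert a B, N.macroOf p.2 = m)
    (hfeas : ∃ θ γ, N.LPFeasible m (insert a B) 1 (fun _ => 1) θ γ) :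
    N.fMacro m (insert a B) - N.fMacro m B ≤ N.fMacro m (insert a A) - N.fMacro m A := by
  have hgr : ∀ C ⊆ insert a B, IsGreatest (Demand.values (N.demand m) C) (N.fMacro m C) := by
    intro C hC
    obtain ⟨θ, γ, h⟩ := hfeas
    rw [← N.setOf_lpObj_eq_values m (N.injOn_fst_of_mem_indep (N.mem_indep_of_subset hC hB))]
    exact N.isGreatest_lpOpt ⟨θ, γ, h.anti hC⟩
  have hv : ∀ p ∈ insert a B, (N.demand m p).Valid := fun p hp =>
    N.valid_demand (hB.1 hp) (hm p hp)
  have haA : insert a A ⊆ insert a B := Finset.insert_subset_insert a hAB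
  have hBB : B ⊆ insert a B := Finset.subset_insert a B
  -- Diminishing returns is the union–intersection inequality for the pair `insert a A`, `B`.
  have e1 : insert a A ∪ B = insert a B := by
    rw [Finset.insert_union, Finset.union_eq_right.2 hAB]
  have e2 : insert a A ∩ B = A := by
    rw [Finset.insert_inter_of_notMem ha, Finset.inter_eq_left.2 hAB]
  have h := Demand.isGreatest_union_add_inter_le (N.demand m) (fun i hi => hv i (haA hi))
    (fun i hi => hv i (hBB hi)) (hgr _ haA) (hgr _ hBB) (e1.symm ▸ hgr _ subset_rfl)
    (e2.symm ▸ hgr _ (hAB.trans hBB))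
  rw [e1, e2] at h
  linarith

end LP

end HetNet

end DualConn
namespace DualConn

namespace HetNet

/-! ### Decomposition of the joint problem -/

section WSR

variable {U M P : Type*} (N : HetNet U M P)

/-- The associations in `G` to picos of `m`. -/
abbrev part [DecidableEq M] (G : Finset (U × P)) (m : M) : Finset (U × P) :=
  G.filter (fun p => N.macroOf p.2 = m)

theorem filter_part_eq_empty_or_singleton [DecidableEq U] [DecidableEq M] {G : Finset (U × P)} (hG : G ∈ N.indep) (u : U) (m : M) :
    (N.part G m).filter (fun p => p.1 = u) = ∅ ∨
      ∃ b, (N.part G m).filter (fun p => p.1 = u) = {(u, b)} := by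
  have h : ((N.part G m).filter (fun p => p.1 = u)).card ≤ 1 :=
    (N.mem_indep_of_subset (Finset.filter_subset _ _) hG).2 u
  rcases Finset.eq_empty_or_nonempty ((N.part G m).filter (fun p => p.1 = u)) with h0 | ⟨⟨v, b⟩, hp⟩
  · exact Or.inl h0
  · obtain rfl : v = u := (Finset.mem_filter.1 hp).2
    refine Or.inr ⟨b, Finset.eq_singleton_iff_unique_mem.2 ⟨hp, fun q hq => ?_⟩⟩
    exact Finset.card_le_one.1 h q hq _ hp

theorem fwsr_empty [Fintype U] [Fintype M] [DecidableEq U] [DecidableEq M] [DecidableEq P] :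
    N.fwsr ∅ = 0 := by
  simp [fwsr, fMacro_empty]

variable [Fintype P] [DecidableEq U] [DecidableEq M] [DecidableEq P]

theorem sum_picos_assoc_mul (G : Finset (U × P)) (u : U) (m : M) (g : P → ℝ) :
    ∑ b ∈ N.picos m, assoc G u b * g b = ∑ p ∈ (N.part G m).filter (fun p => p.1 = u), g p.2 := by
  simp only [assoc, ite_mul, one_mul, zero_mul]
  rw [← Finset.sum_filter]
  refine Finset.sum_nbij' (fun b => (u, b)) Prod.snd ?_ ?_ ?_ ?_ ?_
  · intro b hb
    simpa [picos, and_comm] using hb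
  · rintro ⟨v, b⟩ hb
    obtain ⟨h, rfl⟩ := Finset.mem_filter.1 hb
    simpa [picos, and_comm] using h
  · intro b _
    rfl
  · rintro ⟨v, b⟩ hb
    obtain ⟨h, rfl⟩ := Finset.mem_filter.1 hb
    rfl
  · intro b _
    rfl

theorem sum_picos_assoc (G : Finset (U × P)) (u : U) (m : M) :
    ∑ b ∈ N.picos m, assoc G u b = ((N.part G m).filter (fun p => p.1 = u)).card := by
  have := N.sum_picos_assoc_mul G u m (fun _ => 1)
  simpa using this

/-- The rate of a user is the rate in the linear program of its macro TP. -/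
theorem rate_assoc {G : Finset (U × P)} (hG : G ∈ N.indep) (θ : U → M → ℝ) (γ : U → P → ℝ)
    (u : U) (m : M) (hθ : (N.part G m).filter (fun p => p.1 = u) = ∅ → θ u m = 0) :
    N.rate (assoc G) θ γ u m = ∑ p ∈ (N.part G m).filter (fun p => p.1 = u),
      (N.RM p.1 m * θ p.1 m + N.RP p.1 p.2 * γ p.1 p.2) := by
  unfold rate
  simp only [mul_assoc]
  rw [N.sum_picos_assoc_mul G u m fun b => N.RP u b * γ u b]
  -- In the empty case the macro term is still present on the left; `hθ` removes it.
  rcases N.filter_part_eq_empty_or_singleton hG u m with h | ⟨b, h⟩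
  · simp [h, hθ h]
  · simp [h]

variable [Fintype U] [Fintype M]

theorem wsr_eq_sum_lpObj {G : Finset (U × P)} (hG : G ∈ N.indep) (θ : U → M → ℝ) (γ : U → P → ℝ)
    (hθ : ∀ u m, (N.part G m).filter (fun p => p.1 = u) = ∅ → θ u m = 0) :
    N.wsr (assoc G) θ γ = ∑ m, N.lpObj m (N.part G m) (fun u => θ u m) γ := by
  have h : N.wsr (assoc G) θ γ = ∑ u, ∑ m, N.w u * N.rate (assoc G) θ γ u m := by
    refine Finset.sum_congr rfl fun u _ => Finset.sum_congr rfl fun m _ => ?_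
    rw [rate, mul_add, Finset.mul_sum]
    simp only [mul_assoc]
  rw [h, Finset.sum_comm]
  refine Finset.sum_congr rfl fun m _ => ?_
  rw [lpObj, ← Finset.sum_fiberwise (N.part G m) Prod.fst]
  refine Finset.sum_congr rfl fun u _ => ?_
  rw [N.rate_assoc hG θ γ u m (hθ u m), Finset.mul_sum]
  refine Finset.sum_congr rfl fun p hp => ?_
  obtain rfl := (Finset.mem_filter.1 hp).2
  ring

-- Here `z u m = 0`, so the upper rate bound is `0` even when `Rmax` is `⊤`, and the positive peak
-- rate forces the fraction to vanish.
variable {N} in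
theorem WSRFeasible.eq_zero_of_filter_eq_empty {G : Finset (U × P)} {z : U → M → ℝ}
    {θ : U → M → ℝ} {γ : U → P → ℝ} (h : N.WSRFeasible z (assoc G) θ γ) (u : U) (m : M)
    (he : (N.part G m).filter (fun p => p.1 = u) = ∅) : θ u m = 0 := by
  have hz : z u m = 0 := by
    rw [← h.one_pico, sum_picos_assoc, he]
    simp
  have h1 := h.max_rate u m
  rw [hz, EReal.coe_zero, zero_mul, ← EReal.coe_zero, EReal.coe_le_coe_iff] at h1
  unfold rate at h1
  simp only [mul_assoc] at h1
  rw [N.sum_picos_assoc_mul G u m fun b => N.RP u b * γ u b, he, Finset.sum_empty, add_zero] at h1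
  exact le_antisymm (nonpos_of_mul_nonpos_right h1 (N.RM_pos u m)) (h.θ_mem u m).1

variable {N} in
theorem WSRFeasible.lpFeasible {G : Finset (U × P)} (hG : G ∈ N.indep) {z : U → M → ℝ}
    {θ : U → M → ℝ} {γ : U → P → ℝ} (h : N.WSRFeasible z (assoc G) θ γ) (m : M) :
    N.LPFeasible m (N.part G m) 1 (fun _ => 1) (fun u => θ u m) γ := by
  have key : ∀ p ∈ N.part G m, z p.1 m = 1 ∧ N.rate (assoc G) θ γ p.1 m =
      N.RM p.1 m * θ p.1 m + N.RP p.1 p.2 * γ p.1 p.2 := by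
    intro p hp
    have hmem : p ∈ (N.part G m).filter (fun q => q.1 = p.1) := Finset.mem_filter.2 ⟨hp, rfl⟩
    rcases N.filter_part_eq_empty_or_singleton hG p.1 m with h0 | ⟨b, h0⟩
    · simp [h0] at hmem
    · have hpb : p = (p.1, b) := by rwa [h0, Finset.mem_singleton] at hmem
      have hb : p.2 = b := congrArg Prod.snd hpb
      constructor
      · rw [← h.one_pico, sum_picos_assoc, h0]
        simp
      · rw [N.rate_assoc hG θ γ p.1 m fun he => by simp [he] at h0, h0, Finset.sum_singleton, hb]
  refine ⟨fun u => h.θ_mem u m, h.γ_mem, ?_, fun b _ => ?_, fun p hp => ?_, fun p hp => ?_⟩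
  · exact (Finset.sum_le_sum_of_subset_of_nonneg (Finset.subset_univ _)
      fun u _ _ => (h.θ_mem u m).1).trans (h.macro_budget m)
  · exact (Finset.sum_le_sum_of_subset_of_nonneg (Finset.subset_univ _)
      fun u _ _ => (h.γ_mem u b).1).trans (h.pico_budget b)
  · have := h.min_rate p.1 m
    rwa [(key p hp).1, (key p hp).2, one_mul] at this
  · have := h.max_rate p.1 m
    rwa [(key p hp).1, (key p hp).2, EReal.coe_one, one_mul] at this

/-- Feasible solutions of the linear programs of all macro TPs fit together. -/
theorem exists_wsrFeasible {G : Finset (U × P)} (hG : G ∈ N.indep) {θ : M → U → ℝ}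
    {γ : M → U → P → ℝ} (h : ∀ m, N.LPFeasible m (N.part G m) 1 (fun _ => 1) (θ m) (γ m)) :
    ∃ z θ' γ', N.WSRFeasible z (assoc G) θ' γ' ∧
      N.wsr (assoc G) θ' γ' = ∑ m, N.lpObj m (N.part G m) (θ m) (γ m) := by
  -- The fractions are cut off outside `G`, since they are unconstrained there by the separate
  -- programs; each pico follows the solution of its own macro.
  set z : U → M → ℝ := fun u m => ∑ b ∈ N.picos m, assoc G u b with hz
  set θ' : U → M → ℝ := fun u m => if u ∈ (N.part G m).image Prod.fst then θ m u else 0 with hθ'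
  set γ' : U → P → ℝ := fun u b => if (u, b) ∈ G then γ (N.macroOf b) u b else 0 with hγ'
  have hθe : ∀ u m, (N.part G m).filter (fun p => p.1 = u) = ∅ → θ' u m = 0 := by
    intro u m he
    refine if_neg fun hu => ?_
    obtain ⟨p, hp, hpu⟩ := Finset.mem_image.1 hu
    exact Finset.notMem_empty p (he ▸ Finset.mem_filter.2 ⟨hp, hpu⟩)
  have hθp : ∀ m, ∀ p ∈ N.part G m, θ' p.1 m = θ m p.1 := fun m p hp =>
    if_pos (Finset.mem_image_of_mem _ hp)
  have hγp : ∀ m, ∀ p ∈ N.part G m, γ' p.1 p.2 = γ m p.1 p.2 := by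
    intro m p hp
    obtain ⟨h1, rfl⟩ := Finset.mem_filter.1 hp
    exact if_pos h1
  have hzc : ∀ u m, z u m = ((N.part G m).filter (fun p => p.1 = u)).card := fun u m =>
    N.sum_picos_assoc G u m
  have hcases : ∀ u m, (z u m = 0 ∧ N.rate (assoc G) θ' γ' u m = 0) ∨
      (z u m = 1 ∧ ∃ p ∈ N.part G m, p.1 = u ∧ N.rate (assoc G) θ' γ' u m =
        N.RM p.1 m * θ m p.1 + N.RP p.1 p.2 * γ m p.1 p.2) := by
    intro u m
    rw [hzc, N.rate_assoc hG θ' γ' u m (hθe u m)]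
    rcases N.filter_part_eq_empty_or_singleton hG u m with h0 | ⟨b, h0⟩
    · left
      simp [h0]
    · right
      have hmem : (u, b) ∈ (N.part G m).filter (fun p => p.1 = u) := by simp [h0]
      have hp := (Finset.mem_filter.1 hmem).1
      refine ⟨by simp [h0], (u, b), hp, rfl, ?_⟩
      rw [h0, Finset.sum_singleton, hθp m _ hp, hγp m _ hp]
  refine ⟨z, θ', γ', ⟨?_, ?_, ?_, ?_, ?_, fun _ _ => rfl, ?_, ?_, ?_, ?_⟩, ?_⟩
  · intro u m
    rcases hcases u m with h1 | h1
    · exact Or.inl h1.1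
    · exact Or.inr h1.1
  · intro u b
    unfold assoc
    split_ifs <;> simp
  · intro u m
    simp only [hθ']
    split_ifs
    exacts [(h m).θ_mem u, ⟨le_rfl, zero_le_one⟩]
  · intro u b
    simp only [hγ']
    split_ifs
    exacts [(h _).γ_mem u b, ⟨le_rfl, zero_le_one⟩]
  · intro u
    -- The macros partition the associations of `u` in `G`, of which there is at most one.
    have h1 : ∑ m, ((N.part G m).filter (fun p => p.1 = u)).card =
        (G.filter (fun p => p.1 = u)).card := by
      rw [Finset.card_eq_sum_card_fiberwise (f := fun p => N.macroOf p.2) (t := Finset.univ)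
        fun _ _ => Finset.mem_coe.2 (Finset.mem_univ _)]
      refine Finset.sum_congr rfl fun m _ => ?_
      rw [Finset.filter_comm]
    simp only [hzc]
    rw [← Nat.cast_sum, h1]
    exact_mod_cast hG.2 u
  · intro m
    simp only [hθ']
    rw [Finset.sum_ite_mem, Finset.univ_inter]
    exact (h m).macro_budget
  · intro b
    simp only [hγ']
    rw [← Finset.sum_filter]
    have hpart : ∀ u, (u, b) ∈ G ↔ (u, b) ∈ N.part G (N.macroOf b) := fun u => by simp [part]
    simp only [hpart]
    by_cases hb : b ∈ (N.part G (N.macroOf b)).image Prod.snd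
    · exact (h (N.macroOf b)).pico_budget b hb
    · rw [Finset.sum_eq_zero]
      · exact zero_le_one
      · intro u hu
        exact absurd (Finset.mem_image_of_mem Prod.snd (Finset.mem_filter.1 hu).2) hb
  · intro u m
    rcases hcases u m with ⟨h1, h2⟩ | ⟨h1, p, hp, rfl, h2⟩
    · rw [h1, h2, zero_mul]
    · rw [h1, h2, one_mul]
      exact (h m).min_rate p hp
  · intro u m
    rcases hcases u m with ⟨h1, h2⟩ | ⟨h1, p, hp, rfl, h2⟩
    · rw [h1, h2, EReal.coe_zero, zero_mul]
    · rw [h1, h2, EReal.coe_one, one_mul]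
      exact (h m).max_rate p hp
  · rw [N.wsr_eq_sum_lpObj hG θ' γ' hθe]
    refine Finset.sum_congr rfl fun m _ => Finset.sum_congr rfl fun p hp => ?_
    beta_reduce
    rw [hθp m p hp, hγp m p hp]

theorem mem_feasible_iff {G : Finset (U × P)} :
    G ∈ N.feasible ↔ G ∈ N.indep ∧ ∀ m, ∃ θ γ, N.LPFeasible m (N.part G m) 1 (fun _ => 1) θ γ := by
  constructor
  · rintro ⟨hG, z, θ, γ, h⟩
    exact ⟨hG, fun m => ⟨_, _, h.lpFeasible hG m⟩⟩
  · rintro ⟨hG, h⟩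
    choose θ γ h using h
    obtain ⟨z, θ', γ', h', -⟩ := N.exists_wsrFeasible hG h
    exact ⟨hG, z, θ', γ', h'⟩

theorem empty_mem_feasible : ∅ ∈ N.feasible :=
  N.mem_feasible_iff.2 ⟨⟨by simp, by simp⟩, fun m => ⟨_, _, N.LPFeasible_empty m⟩⟩

theorem mem_feasible_of_subset {A B : Finset (U × P)} (hAB : A ⊆ B) (hB : B ∈ N.feasible) :
    A ∈ N.feasible := by
  rw [mem_feasible_iff] at hB ⊢
  refine ⟨N.mem_indep_of_subset hAB hB.1, fun m => ?_⟩
  obtain ⟨θ, γ, h⟩ := hB.2 m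
  exact ⟨θ, γ, h.anti (Finset.filter_subset_filter _ hAB)⟩

theorem isGreatest_fMacro {G : Finset (U × P)} (hG : G ∈ N.feasible) (m : M) :
    IsGreatest {v : ℝ | ∃ θ γ, N.LPFeasible m (N.part G m) 1 (fun _ => 1) θ γ ∧
      v = N.lpObj m (N.part G m) θ γ} (N.fMacro m (N.part G m)) :=
  N.isGreatest_lpOpt ((N.mem_feasible_iff.1 hG).2 m)

theorem isGreatest_fwsr {G : Finset (U × P)} (hG : G ∈ N.feasible) :
    IsGreatest {v : ℝ | ∃ z θ γ, N.WSRFeasible z (assoc G) θ γ ∧ v = N.wsr (assoc G) θ γ}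
      (N.fwsr G) := by
  constructor
  · choose θ γ h hv using fun m => (N.isGreatest_fMacro hG m).1
    obtain ⟨z, θ', γ', h', hw⟩ := N.exists_wsrFeasible hG.1 h
    exact ⟨z, θ', γ', h', (Finset.sum_congr rfl fun m _ => hv m).trans hw.symm⟩
  · rintro _ ⟨z, θ, γ, h, rfl⟩
    rw [N.wsr_eq_sum_lpObj hG.1 θ γ h.eq_zero_of_filter_eq_empty]
    exact Finset.sum_le_sum fun m _ =>
      (N.isGreatest_fMacro hG m).2 ⟨_, _, h.lpFeasible hG.1 m, rfl⟩

theorem fwsr_nonneg {G : Finset (U × P)} (hG : G ∈ N.feasible) : 0 ≤ N.fwsr G := by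
  refine Finset.sum_nonneg fun m _ => ?_
  obtain ⟨θ, γ, h, hv⟩ := (N.isGreatest_fMacro hG m).1
  exact hv ▸ N.lpObj_nonneg h

theorem submodularOver_fwsr : SubmodularOver N.ground N.feasible N.fwsr := by
  intro A B hAB _ a _ haB hB
  unfold fwsr
  rw [← Finset.sum_sub_distrib, ← Finset.sum_sub_distrib]
  refine Finset.sum_le_sum fun m _ => ?_
  obtain ⟨hi, hf⟩ := N.mem_feasible_iff.1 hB
  have hfm := hf m
  have him := N.mem_indep_of_subset (Finset.filter_subset (fun p => N.macroOf p.2 = m) _) hi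
  have hmm : ∀ p ∈ N.part (insert a B) m, N.macroOf p.2 = m := fun p hp =>
    (Finset.mem_filter.1 hp).2
  unfold part at hfm hmm
  rw [Finset.filter_insert] at hfm him hmm
  rw [Finset.filter_insert, Finset.filter_insert]
  -- Only the macro of `a` sees a change; for every other macro both marginal values are zero.
  split_ifs at hfm him hmm ⊢ with h
  · exact N.fMacro_insert_sub_le (Finset.filter_subset_filter _ hAB)
      (fun h => haB (Finset.mem_filter.1 h).1) him hmm hfm
  · simp

end WSR

/-! ### A network with a non-monotone weighted sum rate -/

/-- Two users, one macro TP and one pico TP. The second user has a low weight and a large minimum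
rate. -/
noncomputable def nonMonotoneNet : HetNet (Fin 2) (Fin 1) (Fin 1) where
  macroOf _ := 0
  R u s := Sum.elim (fun _ => 1) (fun _ => if u = 0 then 1 else 2) s
  w u := if u = 0 then 10 else 1
  Rmin u := if u = 0 then 0 else 2
  Rmax _ := ⊤
  R_pos := by
    rintro u (s | s)
    · simp
    · simp only [Sum.elim_inr]
      split_ifs <;> norm_num
  w_pos u := by split_ifs <;> norm_num
  Rmin_nonneg u := by split_ifs <;> norm_num
  Rmin_le_Rmax _ := le_top
  ratio_ne := by
    intro b u u' h
    fin_cases u <;> fin_cases u' <;> simp_all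

theorem fwsr_nonMonotoneNet (G : Finset (Fin 2 × Fin 1)) :
    nonMonotoneNet.fwsr G = nonMonotoneNet.fMacro 0 (nonMonotoneNet.part G 0) := by
  simp [fwsr]

theorem part_nonMonotoneNet (G : Finset (Fin 2 × Fin 1)) : nonMonotoneNet.part G 0 = G :=
  Finset.filter_true_of_mem fun _ _ => Subsingleton.elim _ _

theorem univ_mem_feasible_nonMonotoneNet :
    (Finset.univ : Finset (Fin 2 × Fin 1)) ∈ nonMonotoneNet.feasible := by
  refine nonMonotoneNet.mem_feasible_iff.2 ⟨⟨?_, by decide⟩, fun m => ?_⟩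
  · rintro ⟨u, b⟩ -
    fin_cases u <;> norm_num [ground, nonMonotoneNet, RM, RP]
  · obtain rfl : m = 0 := Subsingleton.elim _ _
    rw [part_nonMonotoneNet]
    -- The macro goes wholly to user `0` and the pico wholly to user `1`, whose minimum rate `2` is
    -- then met exactly.
    refine ⟨fun u => if u = 0 then 1 else 0, fun u _ => if u = 0 then 0 else 1,
      ⟨?_, ?_, ?_, ?_, ?_, fun _ _ => le_top⟩⟩
    · intro u
      fin_cases u <;> simp
    · intro u _
      fin_cases u <;> simp
    · rw [show (Finset.univ : Finset (Fin 2 × Fin 1)).image Prod.fst = Finset.univ by decide]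
      simp
    · intro b _
      simp
    · rintro ⟨u, b⟩ -
      fin_cases u <;> simp [nonMonotoneNet, RM, RP]

theorem le_fwsr_nonMonotoneNet : 20 ≤ nonMonotoneNet.fwsr {(0, 0)} := by
  have hG := nonMonotoneNet.mem_feasible_of_subset (Finset.subset_univ {(0, 0)})
    univ_mem_feasible_nonMonotoneNet
  rw [fwsr_nonMonotoneNet]
  refine (nonMonotoneNet.isGreatest_fMacro hG 0).2 ?_
  rw [part_nonMonotoneNet]
  -- User `0` alone takes both resources, with value `10 * (1 + 1)`.
  refine ⟨fun u => if u = 0 then 1 else 0, fun u _ => if u = 0 then 1 else 0,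
      ⟨?_, ?_, ?_, ?_, ?_, fun _ _ => le_top⟩, ?_⟩
  · intro u
    fin_cases u <;> simp
  · intro u _
    fin_cases u <;> simp
  · simp
  · intro b _
    exact (Finset.sum_le_sum_of_subset_of_nonneg (Finset.filter_subset _ Finset.univ)
      fun u _ _ => by split_ifs <;> norm_num).trans (by simp)
  · simp [nonMonotoneNet, RM, RP]
  · simp [lpObj, nonMonotoneNet, RM, RP]
    norm_num

theorem fwsr_nonMonotoneNet_univ_le : nonMonotoneNet.fwsr Finset.univ ≤ 12 := by
  obtain ⟨θ, γ, h, hv⟩ :=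
    (nonMonotoneNet.isGreatest_fMacro univ_mem_feasible_nonMonotoneNet 0).1
  rw [fwsr_nonMonotoneNet, hv]
  rw [part_nonMonotoneNet] at h ⊢
  have h1 := h.macro_budget
  rw [show (Finset.univ : Finset (Fin 2 × Fin 1)).image Prod.fst = Finset.univ by decide] at h1
  have h2 := h.pico_budget 0 (by decide)
  have h3 := h.min_rate (1, 0) (Finset.mem_univ _)
  have h4 := (h.θ_mem 1).1
  simp [nonMonotoneNet, RM, RP] at h1 h2 h3
  simp [lpObj, Fintype.sum_prod_type, nonMonotoneNet, RM, RP]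
  -- Dual certificate: both budgets with multiplier `10`, the minimum rate of user `1` with `4`, and
  -- `θ 1 ≥ 0` with `5` give `10 + 10 - 4 * 2 = 12`.
  linarith

end HetNet

end DualConn

theorem mainTheorem1 :
    (∀ (U M P : Type*) [Fintype U] [Fintype M] [Fintype P]
        [DecidableEq U] [DecidableEq M] [DecidableEq P] (N : DualConn.HetNet U M P),
      -- the family of feasible associations is downward closed and contains the empty set
      ∅ ∈ N.feasible ∧
      (∀ A B : Finset (U × P), A ⊆ B → B ∈ N.feasible → A ∈ N.feasible) ∧
      -- the set function is the optimal weighted sum rate for the given association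
      (∀ G ∈ N.feasible,
        IsGreatest {v : ℝ | ∃ z θ γ, N.WSRFeasible z (DualConn.HetNet.assoc G) θ γ ∧
          v = N.wsr (DualConn.HetNet.assoc G) θ γ} (N.fwsr G)) ∧
      (∀ G ∈ N.feasible, ∀ m,
        IsGreatest {v : ℝ | ∃ θ γ,
          N.LPFeasible m (G.filter (fun p => N.macroOf p.2 = m)) 1 (fun _ => 1) θ γ ∧
          v = N.lpObj m (G.filter (fun p => N.macroOf p.2 = m)) θ γ}
          (N.fMacro m (G.filter (fun p => N.macroOf p.2 = m)))) ∧
      -- normalized, non-negative, submodular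
      N.fwsr ∅ = 0 ∧
      (∀ G ∈ N.feasible, 0 ≤ N.fwsr G) ∧
      DualConn.SubmodularOver N.ground N.feasible N.fwsr) ∧
    -- it can be non-monotone
    (∃ (k n l : ℕ) (N : DualConn.HetNet (Fin k) (Fin n) (Fin l)),
      (∃ A ∈ N.feasible, ∃ B ∈ N.feasible, A ⊆ B ∧ N.fwsr B < N.fwsr A) ∧
      (∃ A ∈ N.feasible, ∃ B ∈ N.feasible, A ⊆ B ∧ N.fwsr A < N.fwsr B)) := by
  refine ⟨fun U M P _ _ _ _ _ _ N => ⟨N.empty_mem_feasible, fun A B => N.mem_feasible_of_subset,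
    fun G => N.isGreatest_fwsr, fun G => N.isGreatest_fMacro, N.fwsr_empty,
    fun G => N.fwsr_nonneg, N.submodularOver_fwsr⟩, 2, 1, 1, DualConn.HetNet.nonMonotoneNet, ?_⟩
  have hU := DualConn.HetNet.univ_mem_feasible_nonMonotoneNet
  have h1 := DualConn.HetNet.le_fwsr_nonMonotoneNet
  have h2 := DualConn.HetNet.fwsr_nonMonotoneNet_univ_le
  have h0 := DualConn.HetNet.fwsr_empty DualConn.HetNet.nonMonotoneNet
  have hs := Finset.subset_univ ({(0, 0)} : Finset (Fin 2 × Fin 1))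
  have hG := DualConn.HetNet.nonMonotoneNet.mem_feasible_of_subset hs hU
  exact ⟨⟨_, hG, _, hU, hs, by linarith⟩,
    ⟨∅, DualConn.HetNet.nonMonotoneNet.empty_mem_feasible, _, hG, Finset.empty_subset _,
      by linarith⟩⟩
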